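/- Let $U\colon\mathbb R\to\mathbb R$ be of class $C^1$ with $\min_{\mathbb R} U=0$, such that the set of minimizers $\{x : U(x)=0\}$ is compact, and suppose that there exist $\alpha,R>0$ with $U(x)\ge\alpha|x|^2$ whenever $|x|>R$. Let $T>0$, let $\beta\colon[0,T]\to[1,\infty)$ be smooth ($C^\infty$) and non-decreasing, put $\beta_0:=\beta(0)=\min_{[0,T]}\beta$, and suppose that there exist $R\in\mathbb R$ and $\alpha>0$ such that $$|x|>R \implies x\Big(\beta_0U'(x)-\frac{U'(x)}{U(x)}\Big)\ge\alpha|x| .$$ For $t\in[0,T]$ let $$\pi_t(x):=\frac{e^{-\beta(t)U(x)}}{\int_{\mathbb R} e^{-\beta(t)U(y)}\,dy},\qquad \mu_t(dx):=\pi_t(x)\,dx,$$ $$v_t(x):=\frac{\beta'(t)}{\pi_t(x)}\int_{-\infty}^x\Big(U(y)-\int_{\mathbb R} U\,d\mu_t\Big)\pi_t(y)\,dy .$$ Then for every $1\le p<\infty$: 1. for every $t\in[0,T]$, $U\in L^1(\mu_t)$ and $v_t\in L^p(\mu_t)$, and the function $t\mapsto\|v_t\|_{L^p(\mu_t)}=\big(\int_{\mathbb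 R}|v_t|^p\,d\mu_t\big)^{1/p}$ belongs to $L^1([0,T])$; 2. the Gibbs curve $[0,T]\ni t\mapsto\mu_t\in\mathcal P_p(\mathbb R)$ is absolutely continuous. Here $\mathcal P_p(\mathbb R)$ is the space of probability measures on $\mathbb R$ with finite $p$-th moment, equipped with the Wasserstein distance $W_p(\mu,\nu)=\big(\inf_\gamma\int|x-y|^p\,\gamma(dx,dy)\big)^{1/p}$, the infimum being over all couplings $\gamma$ of $\mu$ and $\nu$. Absolute continuity means that $\mu_t\in\mathcal P_p(\mathbb R)$ for all $t\in[0,T]$, that $t\mapsto\mu_t$ is $W_p$-continuous, that the metric derivative $|\mu'|(t)=\lim_{s\to t}W_p(\mu_s,\mu_t)/|s-t|$ exists for almost every $t\in[0,T]$ and belongs to $L^1([0,T])$, and that $W_p(\mu_s,\mu_t)\le\int_s^t|\mu'|(r)\,dr$ for all $0\le s\le t\le T$. -/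

import Mathlib

open Set Filter Topology MeasureTheory
open scoped ENNReal ContDiff

namespace GibbsCurve

noncomputable section

/-! ### Wasserstein spaces and absolutely continuous curves -/

/-- `μ ∈ 𝒫_p(E)`: a probability measure with finite `p`-th moment about some point. -/
def HasFiniteMoment {E : Type*} [MetricSpace E] [MeasurableSpace E]
    (p : ℝ) (μ : Measure E) : Prop :=
  IsProbabilityMeasure μ ∧ ∃ x₀ : E, ∫⁻ x, edist x x₀ ^ p ∂μ < ⊤

/-- The couplings (transport plans) `Γ(μ, ν)`. -/
def couplings {E : Type*} [MeasurableSpace E] (μ ν : Measure E) : Set (Measure (E × E)) :=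
  {γ | IsProbabilityMeasure γ ∧ γ.fst = μ ∧ γ.snd = ν}

/-- The Wasserstein distance `W_p(μ, ν)`, a priori with values in `[0, ∞]`;
it is finite on `𝒫_p(E)`. -/
def wasserstein {E : Type*} [MetricSpace E] [MeasurableSpace E]
    (p : ℝ) (μ ν : Measure E) : ℝ≥0∞ :=
  (⨅ γ ∈ couplings μ ν, ∫⁻ z, edist z.1 z.2 ^ p ∂γ) ^ (1 / p)

/-- The curve `η`, restricted to `I`, has metric derivative `l` at time `t`:
`W_p(η_t, η_s) / |s - t| → l` as `s → t` in `I`, `s ≠ t`. -/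
def HasMetricDerivWithinAt {E : Type*} [MetricSpace E] [MeasurableSpace E]
    (p : ℝ) (η : ℝ → Measure E) (l : ℝ) (I : Set ℝ) (t : ℝ) : Prop :=
  Tendsto (fun s => (wasserstein p (η t) (η s)).toReal / |s - t|) (𝓝[I \ {t}] t) (𝓝 l)

/-- `η : [a, b] → (𝒫_p(E), W_p)` is an absolutely continuous curve: it is a continuous curve in
`𝒫_p(E)` whose metric derivative `|η'|` exists at almost every time and lies in `L¹([a, b])`, and
`W_p(η_s, η_t) ≤ ∫_s^t |η'|(r) dr` for all `s ≤ t`. -/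
structure IsAbsolutelyContinuousCurve {E : Type*} [MetricSpace E] [MeasurableSpace E]
    (p : ℝ) (a b : ℝ) (η : ℝ → Measure E) : Prop where
  hasFiniteMoment : ∀ t ∈ Icc a b, HasFiniteMoment p (η t)
  continuous : ∀ t ∈ Icc a b, Tendsto (fun s => wasserstein p (η t) (η s)) (𝓝[Icc a b] t) (𝓝 0)
  exists_metricDeriv : ∃ m : ℝ → ℝ, IntegrableOn m (Icc a b) ∧
    (∀ᵐ t ∂(volume.restrict (Icc a b)), HasMetricDerivWithinAt p η (m t) (Icc a b) t) ∧
    ∀ s ∈ Icc a b, ∀ t ∈ Icc a b, s ≤ t →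
      wasserstein p (η s) (η t) ≤ ENNReal.ofReal (∫ r in s..t, m r)

/-! ### Gibbs measures on the line and the explicit velocity field -/

/-- The Gibbs density `e^{-b U(x)} / ∫ e^{-b U(y)} dy` at inverse temperature `b`. -/
def gibbsDensity (U : ℝ → ℝ) (b : ℝ) (x : ℝ) : ℝ :=
  Real.exp (-b * U x) / ∫ y, Real.exp (-b * U y)

/-- The Gibbs measure at inverse temperature `b`. -/
def gibbsMeasure (U : ℝ → ℝ) (b : ℝ) : Measure ℝ :=
  volume.withDensity fun x => ENNReal.ofReal (gibbsDensity U b x)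

/-- The Gibbs curve `t ↦ μ_t = μ_{β(t)}`. -/
def gibbsCurve (U : ℝ → ℝ) (β : ℝ → ℝ) (t : ℝ) : Measure ℝ :=
  gibbsMeasure U (β t)

/-- The field `v_t(x) = (β'(t) / π_t(x)) ∫_{-∞}^x (U(y) - ∫ U dμ_t) π_t(y) dy`, where `β` is a
function on `[0, T]` (its derivative is one-sided at the end points). -/
def velocity (U : ℝ → ℝ) (β : ℝ → ℝ) (T : ℝ) (t x : ℝ) : ℝ :=
  derivWithin β (Icc 0 T) t / gibbsDensity U (β t) x *
    ∫ y in Iic x, (U y - ∫ z, U z ∂(gibbsCurve U β t)) * gibbsDensity U (β t) y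

end

end GibbsCurve

/-! Parametrize by the inverse temperature `c`; let `F_c` and `Q_c` be the distribution and quantile
functions of the Gibbs measure `μ_c`. Differentiation under the integral gives `∂_c F_c =
-gibbsFlux`, and implicit differentiation of `F_c (Q_c u) = u` gives `∂_c Q_c = w_c ∘ Q_c` with `w_c
= gibbsField U c` (`hasDerivAt_gibbsQuantile`). By the chain rule, `v_t = β'(t) w_{β(t)}`. Since
`Q_c` pushes Lebesgue measure on `(0, 1)` to `μ_c`, the pair `(Q_a, Q_b)` yields a coupling. Hölder
in `c` and Tonelli then bound `W_p(μ_a, μ_b)` by `(b - a) sup_c ‖w_c‖_{L^p(μ_c)}`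
(`wasserstein_gibbsMeasure_le`). The analytic core is `|w_c| ≤ C (1 + U)`, uniformly for `c` in `[β
0, β T]` (`exists_abs_gibbsField_le`): the gradient condition makes `U π_c` decay at exponential
rate `α` in the tails, so its tail integrals are controlled by its boundary value. Quadratic growth
of `U` bounds the moments of `1 + U` uniformly, which settles the `L^p` claims. As `β` is Lipschitz,
so is the Gibbs curve, and Lipschitz curves are absolutely continuous
(`isAbsolutelyContinuousCurve_of_lipschitz`). -/

namespace GibbsCurve

/-! ### Metric derivatives of Lipschitz curves -/

/-- A Lipschitz curve in a pseudometric space, given by the distances `d s t` of its points, has a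
metric derivative at almost every time, and the distances are bounded by its integrals. -/
theorem exists_metricDeriv_of_lipschitz {d : ℝ → ℝ → ℝ} {L : ℝ} (hsymm : ∀ s t, d s t = d t s)
    (htri : ∀ r s t, d r t ≤ d r s + d s t) (hlip : ∀ s t, d s t ≤ L * |s - t|) :
    ∃ m : ℝ → ℝ, Measurable m ∧ (∀ t, 0 ≤ m t ∧ m t ≤ L) ∧
      (∀ᵐ t, Tendsto (fun s => d t s / |s - t|) (𝓝[≠] t) (𝓝 (m t))) ∧
      ∀ s t, s ≤ t → d s t ≤ ∫ r in s..t, m r := by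
  have hdiff : ∀ r s t, |d r s - d r t| ≤ d s t := fun r s t => by
    rw [abs_sub_le_iff]
    constructor
    · linarith [htri r t s, hsymm s t]
    · linarith [htri r s t]
  have hL : 0 ≤ L := by
    have h1 := (abs_nonneg _).trans ((hdiff 0 0 1).trans (hlip 0 1))
    simpa using h1
  have hlipq : ∀ q, LipschitzWith ⟨L, hL⟩ (d q) := fun q =>
    LipschitzWith.of_dist_le_mul fun s t => by
      rw [Real.dist_eq, Real.dist_eq]
      exact (hdiff q s t).trans (hlip s t)
  have hbd : ∀ q t, |deriv (d q) t| ≤ L := fun q t =>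
    norm_deriv_le_of_lipschitz (hlipq q)
  -- The metric derivative is the supremum of the speeds seen from rational times. Countability
  -- gives measurability and a single null set off which all `d q` are differentiable.
  set m : ℝ → ℝ := fun t => ⨆ q : ℚ, |deriv (d q) t| with hm
  have hbdd : ∀ t, BddAbove (range fun q : ℚ => |deriv (d q) t|) := fun t =>
    ⟨L, by rintro _ ⟨q, rfl⟩; exact hbd q t⟩
  have hle : ∀ t (q : ℚ), |deriv (d q) t| ≤ m t := fun t q => le_ciSup (hbdd t) q
  have hm0 : ∀ t, 0 ≤ m t := fun t => (abs_nonneg _).trans (hle t 0)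
  have hmL : ∀ t, m t ≤ L := fun t => ciSup_le fun q => hbd q t
  have hmeas : Measurable m :=
    Measurable.iSup fun q => (measurable_deriv _).abs
  have hint : ∀ a b, IntervalIntegrable m volume a b := fun a b =>
    (intervalIntegrable_const (c := L)).mono_fun hmeas.aestronglyMeasurable
      (Eventually.of_forall fun t => by
        show ‖m t‖ ≤ ‖L‖
        rw [Real.norm_of_nonneg (hm0 t), Real.norm_of_nonneg hL]; exact hmL t)
  have hloc : LocallyIntegrable m volume := fun t =>
    ⟨Icc (t - 1) (t + 1), Icc_mem_nhds (by linarith) (by linarith), by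
      rw [← intervalIntegrable_iff_integrableOn_Icc_of_le (by linarith)]; exact hint _ _⟩
  have hub : ∀ s t, s ≤ t → d s t ≤ ∫ r in s..t, m r := by
    intro s t hst
    -- Pass through `q` and integrate `deriv (d q)`; the detour costs `d s q + d q s`, which
    -- vanishes as `q → s`.
    have hq : ∀ q : ℚ, d s t ≤ 2 * L * |(q : ℝ) - s| + ∫ r in s..t, m r := by
      intro q
      have hac : AbsolutelyContinuousOnInterval (d q) s t :=
        ((hlipq q).lipschitzOnWith (s := uIcc s t)).absolutelyContinuousOnInterval
      have h1 := hac.integral_deriv_eq_sub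
      have h2 : ∫ r in s..t, deriv (d q) r ≤ ∫ r in s..t, m r :=
        intervalIntegral.integral_mono_on hst hac.intervalIntegrable_deriv (hint s t)
          fun r _ => (le_abs_self _).trans (hle r q)
      have h3 := htri s q t
      have h4 := hlip q s
      have h5 := hsymm s q
      linarith
    have hcont : Continuous fun q : ℝ => 2 * L * |q - s| + ∫ r in s..t, m r := by fun_prop
    have hall : ∀ q : ℝ, d s t ≤ 2 * L * |q - s| + ∫ r in s..t, m r := by
      have hclosed := isClosed_le (continuous_const (y := d s t)) hcont
      have hsub : range ((↑) : ℚ → ℝ) ⊆ {q : ℝ | d s t ≤ 2 * L * |q - s| + ∫ r in s..t, m r} := by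
        rintro _ ⟨q, rfl⟩; exact hq q
      intro q
      exact hclosed.closure_subset_iff.2 hsub (Rat.denseRange_cast q)
    simpa using hall s
  refine ⟨m, hmeas, fun t => ⟨hm0 t, hmL t⟩, ?_, hub⟩
  have hae : ∀ᵐ t, ∀ q : ℚ, DifferentiableAt ℝ (d q) t :=
    ae_all_iff.2 fun q => (hlipq q).ae_differentiableAt
  filter_upwards [hae, LocallyIntegrable.ae_hasDerivAt_integral hloc] with t ht hLeb
  have hslope : ∀ {f : ℝ → ℝ} {f' : ℝ}, HasDerivAt f f' t →
      Tendsto (fun s => |f s - f t| / |s - t|) (𝓝[≠] t) (𝓝 |f'|) := by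
    intro f f' hf
    refine (hasDerivAt_iff_tendsto_slope.1 hf).abs.congr fun s => ?_
    rw [slope_def_field, abs_div]
  rw [tendsto_order]
  constructor
  -- Lower bound: by the reverse triangle inequality, every difference quotient of `d q` is at most
  -- that of the curve.
  · intro a ha
    obtain ⟨q, hq⟩ := exists_lt_of_lt_ciSup ha
    filter_upwards [(tendsto_order.1 (hslope (ht q).hasDerivAt)).1 a hq] with s hs
    refine hs.trans_le ?_
    gcongr
    exact (hdiff q s t).trans_eq (hsymm s t)
  -- Upper bound: `t` is a Lebesgue differentiation point of `m`.
  · intro a ha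
    have h := hslope (hLeb t)
    rw [abs_of_nonneg (hm0 t)] at h
    filter_upwards [(tendsto_order.1 h).2 a ha] with s hs
    refine lt_of_le_of_lt ?_ hs
    gcongr
    rw [intervalIntegral.integral_same, sub_zero]
    rcases le_total t s with hts | hts
    · exact (hub t s hts).trans (le_abs_self _)
    · rw [hsymm, intervalIntegral.integral_symm, abs_neg]
      exact (hub s t hts).trans (le_abs_self _)

/-! ### The Wasserstein distance is a pseudodistance -/

theorem map_swap_mem_couplings {E : Type*} [MeasurableSpace E] {μ ν : Measure E} {γ : Measure (E × E)} (hγ : γ ∈ couplings μ ν) :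
    γ.map Prod.swap ∈ couplings ν μ := by
  obtain ⟨h, h1, h2⟩ := hγ
  refine ⟨Measure.isProbabilityMeasure_map measurable_swap.aemeasurable, ?_, ?_⟩
  · rw [Measure.fst_map_swap, h2]
  · rw [Measure.snd_map_swap, h1]

open ProbabilityTheory in
/-- Two couplings with a common marginal are the marginals of a measure on the triple product. -/
theorem exists_gluing {E : Type*} [MeasurableSpace E] [StandardBorelSpace E] [Nonempty E] {μ ν ρ : Measure E}
    {γ δ : Measure (E × E)} (hγ : γ ∈ couplings μ ν) (hδ : δ ∈ couplings ν ρ) :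
    ∃ σ : Measure ((E × E) × E), IsProbabilityMeasure σ ∧ σ.map Prod.fst = γ ∧
      σ.map (fun z => (z.1.2, z.2)) = δ := by
  obtain ⟨hγp, -, hγ2⟩ := hγ
  obtain ⟨hδp, hδ1, -⟩ := hδ
  -- Draw the third point from the conditional law of `δ` given the middle point, independently of
  -- the first.
  refine ⟨γ ⊗ₘ (δ.condKernel.comap Prod.snd measurable_snd), inferInstance, ?_, ?_⟩
  · exact Measure.fst_compProd _ _
  · ext s hs
    have hmeas : Measurable fun z : (E × E) × E => (z.1.2, z.2) := by fun_prop
    rw [Measure.map_apply hmeas hs, Measure.compProd_apply (hmeas hs)]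
    conv_rhs => rw [← δ.disintegrate δ.condKernel, Measure.compProd_apply hs, hδ1, ← hγ2,
      Measure.snd, lintegral_map (Kernel.measurable_kernel_prodMk_left hs) measurable_snd]
    rfl

section Wasserstein

variable {E : Type*} [MetricSpace E] [MeasurableSpace E]

/-- The power `1 / p` is an order isomorphism of `[0, ∞]`, so it commutes with infima. Estimates can
then be made coupling by coupling, without optimal plans. -/
theorem wasserstein_eq_iInf {p : ℝ} (hp : 1 ≤ p) (μ ν : Measure E) :
    wasserstein p μ ν = ⨅ γ ∈ couplings μ ν, (∫⁻ z, edist z.1 z.2 ^ p ∂γ) ^ (1 / p) := by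
  have h0 : 0 < 1 / p := by positivity
  exact ((ENNReal.orderIsoRpow (1 / p) h0).map_iInf _).trans
    (iInf_congr fun _ => (ENNReal.orderIsoRpow (1 / p) h0).map_iInf _)

theorem wasserstein_le_of_mem_couplings {p : ℝ} (hp : 1 ≤ p) {μ ν : Measure E}
    {γ : Measure (E × E)} (hγ : γ ∈ couplings μ ν) :
    wasserstein p μ ν ≤ (∫⁻ z, edist z.1 z.2 ^ p ∂γ) ^ (1 / p) := by
  rw [wasserstein_eq_iInf hp]
  exact iInf₂_le γ hγ

theorem wasserstein_comm {p : ℝ} [BorelSpace E] [SecondCountableTopology E] (μ ν : Measure E) :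
    wasserstein p μ ν = wasserstein p ν μ := by
  have key : ∀ μ ν : Measure E, (⨅ γ ∈ couplings μ ν, ∫⁻ z, edist z.1 z.2 ^ p ∂γ) ≤
      ⨅ γ ∈ couplings ν μ, ∫⁻ z, edist z.1 z.2 ^ p ∂γ := by
    intro μ ν
    refine le_iInf₂ fun γ hγ => (iInf₂_le _ (map_swap_mem_couplings hγ)).trans_eq ?_
    rw [lintegral_map (by fun_prop) measurable_swap]
    simp [edist_comm]
  rw [wasserstein, wasserstein, le_antisymm (key μ ν) (key ν μ)]

/-- Glue the two couplings along `ν` and apply Minkowski's inequality on the triple product. -/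
theorem wasserstein_triangle {p : ℝ} (hp : 1 ≤ p) [StandardBorelSpace E] [Nonempty E]
    [BorelSpace E] [SecondCountableTopology E] (μ ν ρ : Measure E) :
    wasserstein p μ ρ ≤ wasserstein p μ ν + wasserstein p ν ρ := by
  rw [wasserstein_eq_iInf hp μ ν, wasserstein_eq_iInf hp ν ρ]
  simp only [ENNReal.iInf_add, ENNReal.add_iInf]
  refine le_iInf₂ fun δ hδ => le_iInf₂ fun γ hγ => ?_
  obtain ⟨σ, hσ, hσγ, hσδ⟩ := exists_gluing hγ hδ
  have m12 : Measurable fun z : (E × E) × E => z.1 := measurable_fst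
  have m23 : Measurable fun z : (E × E) × E => (z.1.2, z.2) := by fun_prop
  have m13 : Measurable fun z : (E × E) × E => (z.1.1, z.2) := by fun_prop
  have hmem : σ.map (fun z => (z.1.1, z.2)) ∈ couplings μ ρ := by
    refine ⟨Measure.isProbabilityMeasure_map m13.aemeasurable, ?_, ?_⟩
    · rw [← hγ.2.1, ← hσγ, Measure.fst, Measure.fst, Measure.map_map measurable_fst m13,
        Measure.map_map measurable_fst m12]
      rfl
    · rw [← hδ.2.2, ← hσδ, Measure.snd, Measure.snd, Measure.map_map measurable_snd m13,
        Measure.map_map measurable_snd m23]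
      rfl
  refine (wasserstein_le_of_mem_couplings hp hmem).trans ?_
  rw [← hσγ, ← hσδ, lintegral_map (by fun_prop) m12, lintegral_map (by fun_prop) m23,
    lintegral_map (by fun_prop) m13]
  refine le_trans ?_ (ENNReal.lintegral_Lp_add_le (μ := σ) (p := p)
    (f := fun z => edist z.1.1 z.1.2) (g := fun z => edist z.1.2 z.2)
    (by fun_prop) (by fun_prop) hp)
  gcongr with z
  exact edist_triangle _ _ _

end Wasserstein

/-- A curve of probability measures on the line which is Lipschitz for the Wasserstein distance is
absolutely continuous. -/
theorem isAbsolutelyContinuousCurve_of_lipschitz {p : ℝ} (hp : 1 ≤ p) {a b L : ℝ} (hab : a ≤ b)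
    {η : ℝ → Measure ℝ} (hη : ∀ t ∈ Icc a b, HasFiniteMoment p (η t))
    (hlip : ∀ s ∈ Icc a b, ∀ t ∈ Icc a b,
      wasserstein p (η s) (η t) ≤ ENNReal.ofReal (L * |s - t|)) :
    IsAbsolutelyContinuousCurve p a b η := by
  -- Projecting times onto `[a, b]` extends the curve to the whole line with the same Lipschitz
  -- bound.
  set c : ℝ → ℝ := fun t => projIcc a b hab t with hc
  have hcmem : ∀ t, c t ∈ Icc a b := fun t => (projIcc a b hab t).2
  have hceq : ∀ t ∈ Icc a b, c t = t := fun t ht => by simp [hc, projIcc_of_mem hab ht]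
  have hclip : ∀ s t, |c s - c t| ≤ |s - t| := fun s t => by
    have := (LipschitzWith.projIcc hab).dist_le_mul s t
    simpa [Subtype.dist_eq, Real.dist_eq] using this
  have hfin : ∀ s t, wasserstein p (η (c s)) (η (c t)) ≠ ⊤ := fun s t =>
    ((hlip _ (hcmem s) _ (hcmem t)).trans_lt ENNReal.ofReal_lt_top).ne
  set d : ℝ → ℝ → ℝ := fun s t => (wasserstein p (η (c s)) (η (c t))).toReal with hd
  have hlip' : ∀ s ∈ Icc a b, ∀ t ∈ Icc a b,
      wasserstein p (η s) (η t) ≤ ENNReal.ofReal (max L 0 * |s - t|) := fun s hs t ht =>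
    (hlip s hs t ht).trans (ENNReal.ofReal_le_ofReal (by gcongr; exact le_max_left _ _))
  obtain ⟨m, hm, hmb, hder, hle⟩ := exists_metricDeriv_of_lipschitz (d := d) (L := max L 0)
    (fun s t => by simp only [hd]; rw [wasserstein_comm])
    (fun r s t => by
      simp only [hd]
      rw [← ENNReal.toReal_add (hfin _ _) (hfin _ _)]
      exact ENNReal.toReal_mono (ENNReal.add_ne_top.2 ⟨hfin _ _, hfin _ _⟩)
        (wasserstein_triangle hp _ _ _))
    (fun s t => by
      have h1 := ENNReal.toReal_mono ENNReal.ofReal_ne_top (hlip' _ (hcmem s) _ (hcmem t))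
      rw [ENNReal.toReal_ofReal (by positivity)] at h1
      exact h1.trans (mul_le_mul_of_nonneg_left (hclip s t) (le_max_right _ _)))
  refine ⟨hη, fun t ht => ?_, m, ?_, ?_, fun s hs t ht hst => ?_⟩
  · have h1 : Tendsto (fun s => ENNReal.ofReal (L * |t - s|)) (𝓝[Icc a b] t) (𝓝 0) := by
      have hcont : Continuous fun s => ENNReal.ofReal (L * |t - s|) :=
        ENNReal.continuous_ofReal.comp (by fun_prop)
      have := (hcont.tendsto t).mono_left (nhdsWithin_le_nhds (s := Icc a b))
      simpa using this
    refine tendsto_of_tendsto_of_tendsto_of_le_of_le' tendsto_const_nhds h1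
      (Eventually.of_forall fun _ => zero_le) ?_
    filter_upwards [self_mem_nhdsWithin] with s hs using hlip t ht s hs
  · refine Integrable.mono' (g := fun _ => max L 0) (integrable_const _)
      hm.aestronglyMeasurable (Eventually.of_forall fun t => ?_)
    rw [Real.norm_of_nonneg (hmb t).1]; exact (hmb t).2
  · filter_upwards [ae_restrict_of_ae hder, ae_restrict_mem measurableSet_Icc] with t ht htm
    refine (ht.mono_left (nhdsWithin_mono _ (by
      rw [sdiff_eq]; exact inter_subset_right))).congr' ?_
    filter_upwards [self_mem_nhdsWithin] with s hs
    simp only [hd]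
    rw [hceq t htm, hceq s hs.1]
  · have h1 := hle s t hst
    simp only [hd] at h1
    rw [hceq s hs, hceq t ht] at h1
    rw [← ENNReal.ofReal_toReal (((hlip s hs t ht).trans_lt ENNReal.ofReal_lt_top).ne)]
    exact ENNReal.ofReal_le_ofReal h1

/-! ### Exponential moments of a confining potential -/

/-- A continuous non-negative potential with at least quadratic growth. -/
structure IsConfining (U : ℝ → ℝ) : Prop where
  continuous : Continuous U
  nonneg : ∀ x, 0 ≤ U x
  quadratic : ∃ a > 0, ∃ b, ∀ x, a * x ^ 2 ≤ U x + b

theorem exists_one_add_rpow_le_exp {q δ : ℝ} (hq : 1 ≤ q) (hδ : 0 < δ) :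
    ∃ K > 0, ∀ u, 0 ≤ u → (1 + u) ^ q ≤ K * Real.exp (δ * u) := by
  have hq0 : 0 < q := by linarith
  -- This `A` comes from `v + 1 ≤ exp v` at `v = δ u / q`, raised to the power `q`.
  set A := max 1 (q / δ) with hA
  have hA0 : 0 < A := lt_max_of_lt_left one_pos
  refine ⟨A ^ q, by positivity, fun u hu => ?_⟩
  have h1 : 1 + u ≤ A * Real.exp (δ * u / q) := by
    have h2 : δ * u / q + 1 ≤ Real.exp (δ * u / q) := Real.add_one_le_exp _
    have h3 : u = q / δ * (δ * u / q) := by field_simp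
    have h4 : 0 ≤ δ * u / q := by positivity
    calc 1 + u = 1 + q / δ * (δ * u / q) := by rw [← h3]
      _ ≤ A + A * (δ * u / q) := by
        gcongr
        · exact le_max_left _ _
        · exact le_max_right _ _
      _ = A * (δ * u / q + 1) := by ring
      _ ≤ _ := by gcongr
  calc (1 + u) ^ q ≤ (A * Real.exp (δ * u / q)) ^ q := by gcongr
    _ = A ^ q * Real.exp (δ * u) := by
      rw [Real.mul_rpow hA0.le (Real.exp_pos _).le, ← Real.exp_mul]
      congr 2
      field_simp

namespace IsConfining

variable {U : ℝ → ℝ} (hU : IsConfining U)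
include hU

theorem integrable_exp {c : ℝ} (hc : 0 < c) : Integrable fun x => Real.exp (-c * U x) := by
  obtain ⟨a, ha, b, hb⟩ := hU.quadratic
  have hcont := hU.continuous
  refine ((integrable_exp_neg_mul_sq (mul_pos hc ha)).const_mul (Real.exp (c * b))).mono'
    (by fun_prop) (Eventually.of_forall fun x => ?_)
  rw [Real.norm_of_nonneg (Real.exp_pos _).le, ← Real.exp_add]
  refine Real.exp_le_exp.2 ?_
  nlinarith [mul_le_mul_of_nonneg_left (hb x) hc.le]

/-- Half of the exponential weight absorbs the power; the other half remains integrable. -/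
theorem integrable_one_add_rpow {q c : ℝ} (hq : 1 ≤ q) (hc : 0 < c) :
    Integrable fun x => (1 + U x) ^ q * Real.exp (-c * U x) := by
  obtain ⟨K, hK, hKle⟩ := exists_one_add_rpow_le_exp hq (half_pos hc)
  have hcont := hU.continuous
  refine ((hU.integrable_exp (half_pos hc)).const_mul K).mono' (Continuous.aestronglyMeasurable
    (Continuous.mul (Continuous.rpow_const (by fun_prop) fun x => Or.inr (by linarith))
      (by fun_prop))) (Eventually.of_forall fun x => ?_)
  have h0 := hU.nonneg x
  rw [Real.norm_of_nonneg (by positivity)]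
  calc (1 + U x) ^ q * Real.exp (-c * U x)
      ≤ K * Real.exp (c / 2 * U x) * Real.exp (-c * U x) := by gcongr; exact hKle _ h0
    _ = K * Real.exp (-(c / 2) * U x) := by
      rw [mul_assoc, ← Real.exp_add]; congr 2; ring

theorem integrable_pow (k : ℕ) {c : ℝ} (hc : 0 < c) :
    Integrable fun x => U x ^ k * Real.exp (-c * U x) := by
  have hcont := hU.continuous
  -- The exponent is `k + 1` so that it is at least `1` also for `k = 0`.
  refine (hU.integrable_one_add_rpow (q := k + 1) (by simp) hc).mono' (by fun_prop)
    (Eventually.of_forall fun x => ?_)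
  have h0 := hU.nonneg x
  rw [Real.norm_of_nonneg (by positivity)]
  gcongr
  calc U x ^ k ≤ (1 + U x) ^ k := by gcongr; linarith
    _ ≤ (1 + U x) ^ (k + 1) := pow_le_pow_right₀ (by linarith) (by simp)
    _ = (1 + U x) ^ ((k : ℝ) + 1) := by rw [← Real.rpow_natCast]; push_cast; rfl

/-- Each derivative in `c` brings down a factor `-U`; on `c' > c / 2` it is dominated by the
integrand at `c / 2`. -/
theorem hasDerivAt_setIntegral_pow (k : ℕ) (S : Set ℝ) {c : ℝ} (hc : 0 < c) :
    HasDerivAt (fun c => ∫ x in S, U x ^ k * Real.exp (-c * U x))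
      (-∫ x in S, U x ^ (k + 1) * Real.exp (-c * U x)) c := by
  have hcont := hU.continuous
  rw [← integral_neg]
  refine (hasDerivAt_integral_of_dominated_loc_of_deriv_le (s := Ioi (c / 2))
    (F := fun c x => U x ^ k * Real.exp (-c * U x))
    (F' := fun c x => -(U x ^ (k + 1) * Real.exp (-c * U x))) (μ := volume.restrict S)
    (bound := fun x => U x ^ (k + 1) * Real.exp (-(c / 2) * U x))
    (Ioi_mem_nhds (by linarith)) (Eventually.of_forall fun c => by fun_prop)
    (hU.integrable_pow k hc).integrableOn (by fun_prop)
    (Eventually.of_forall fun x c' hc' => ?_) (hU.integrable_pow (k + 1) (half_pos hc)).integrableOn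
    (Eventually.of_forall fun x c' hc' => ?_)).2
  · have h0 := hU.nonneg x
    rw [norm_neg, Real.norm_of_nonneg (by positivity)]
    have : c / 2 ≤ c' := le_of_lt hc'
    gcongr
  · have h : HasDerivAt (fun c : ℝ => -c * U x) (-1 * U x) c' :=
      (hasDerivAt_id c').neg.mul_const _
    convert! h.exp.const_mul (U x ^ k) using 1
    ring

/-- Dominated convergence: the indicator is discontinuous in the end point only at `x = y`, a null
set. -/
theorem continuousAt_integral_Iic_pow (k : ℕ) {c : ℝ} (hc : 0 < c) (y : ℝ) :
    ContinuousAt (fun z : ℝ × ℝ => ∫ x in Iic z.2, U x ^ k * Real.exp (-z.1 * U x)) (c, y) := by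
  have hcont := hU.continuous
  simp_rw [← integral_indicator (measurableSet_Iic (a := (_ : ℝ)))]
  refine continuousAt_of_dominated (bound := fun x => U x ^ k * Real.exp (-(c / 2) * U x))
    (Eventually.of_forall fun z => Measurable.aestronglyMeasurable
      (Measurable.indicator (by fun_prop) measurableSet_Iic)) ?_
    (hU.integrable_pow k (half_pos hc)) ?_
  · have hev : ∀ᶠ z : ℝ × ℝ in 𝓝 (c, y), c / 2 < z.1 :=
      continuous_fst.continuousAt.eventually (lt_mem_nhds (half_lt_self hc))
    filter_upwards [hev] with z hz
    refine Eventually.of_forall fun x => (norm_indicator_le_norm_self _ _).trans ?_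
    have h0 := hU.nonneg x
    rw [Real.norm_of_nonneg (by positivity)]
    gcongr
  · filter_upwards [compl_mem_ae_iff.2 (measure_singleton y)] with x hx
    have hc2 : ContinuousAt (fun z : ℝ × ℝ => U x ^ k * Real.exp (-z.1 * U x)) (c, y) := by
      fun_prop
    rcases lt_or_gt_of_ne hx with h | h
    · refine hc2.congr ?_
      filter_upwards [continuous_snd.continuousAt.eventually (lt_mem_nhds (a := x) h)] with z hz
      rw [indicator_of_mem (by exact le_of_lt hz)]
    · refine (continuousAt_const (y := (0 : ℝ))).congr ?_
      filter_upwards [continuous_snd.continuousAt.eventually (gt_mem_nhds h)] with z hz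
      have hx' : x ∉ Iic z.2 := not_le.2 hz
      rw [indicator_of_notMem hx']

theorem continuousAt_integral_pow (k : ℕ) {c : ℝ} (hc : 0 < c) :
    ContinuousAt (fun c => ∫ x, U x ^ k * Real.exp (-c * U x)) c := by
  simpa using (hU.hasDerivAt_setIntegral_pow k univ hc).continuousAt

theorem integral_exp_pos {c : ℝ} (hc : 0 < c) : 0 < ∫ x, Real.exp (-c * U x) :=
  MeasureTheory.integral_exp_pos (hU.integrable_exp hc)

theorem hasDerivAt_integral_Iic_pow (k : ℕ) {c : ℝ} (hc : 0 < c) (y : ℝ) :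
    HasDerivAt (fun y => ∫ x in Iic y, U x ^ k * Real.exp (-c * U x))
      (U y ^ k * Real.exp (-c * U y)) y := by
  have hcont : Continuous fun x => U x ^ k * Real.exp (-c * U x) := by
    have := hU.continuous; fun_prop
  have hint := hU.integrable_pow k hc
  have h := (intervalIntegral.integral_hasDerivAt_right
    (hcont.intervalIntegrable 0 y) (hcont.stronglyMeasurableAtFilter _ _) hcont.continuousAt).const_add
      (∫ x in Iic 0, U x ^ k * Real.exp (-c * U x))
  refine h.congr_of_eventuallyEq (Eventually.of_forall fun z => ?_)
  have := intervalIntegral.integral_Iic_sub_Iic (a := 0) (b := z) hint.integrableOn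
    hint.integrableOn
  simp only at this ⊢
  linarith

/-! ### Gibbs densities, their distribution functions and fluxes -/

theorem gibbsDensity_pos {c : ℝ} (hc : 0 < c) (x : ℝ) : 0 < gibbsDensity U c x :=
  div_pos (Real.exp_pos _) (hU.integral_exp_pos hc)

theorem continuousAt_gibbsDensity {c : ℝ} (hc : 0 < c) (x : ℝ) :
    ContinuousAt (fun z : ℝ × ℝ => gibbsDensity U z.1 z.2) (c, x) := by
  have hcont := hU.continuous
  have h := hU.continuousAt_integral_pow 0 hc
  simp only [pow_zero, one_mul] at h
  refine ContinuousAt.div (by fun_prop) ?_ (hU.integral_exp_pos hc).ne'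
  exact h.comp_of_eq continuousAt_fst rfl

theorem continuous_gibbsDensity (c : ℝ) : Continuous (gibbsDensity U c) := by
  have hcont := hU.continuous
  unfold gibbsDensity
  fun_prop

theorem integrable_gibbsDensity {c : ℝ} (hc : 0 < c) : Integrable (gibbsDensity U c) :=
  (hU.integrable_exp hc).div_const _

theorem integral_gibbsDensity {c : ℝ} (hc : 0 < c) : ∫ x, gibbsDensity U c x = 1 := by
  unfold gibbsDensity
  rw [integral_div, div_self (hU.integral_exp_pos hc).ne']

theorem gibbsMeasure_apply {c : ℝ} (hc : 0 < c) {S : Set ℝ} (hS : MeasurableSet S) :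
    gibbsMeasure U c S = ENNReal.ofReal (∫ x in S, gibbsDensity U c x) := by
  rw [gibbsMeasure, withDensity_apply _ hS, ofReal_integral_eq_lintegral_ofReal
    (hU.integrable_gibbsDensity hc).integrableOn
    (Eventually.of_forall fun x => (hU.gibbsDensity_pos hc x).le)]

theorem isProbabilityMeasure_gibbsMeasure {c : ℝ} (hc : 0 < c) :
    IsProbabilityMeasure (gibbsMeasure U c) :=
  ⟨by rw [hU.gibbsMeasure_apply hc MeasurableSet.univ, setIntegral_univ,
    hU.integral_gibbsDensity hc, ENNReal.ofReal_one]⟩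

theorem integrable_gibbsMeasure_iff {c : ℝ} (hc : 0 < c) {f : ℝ → ℝ} :
    Integrable f (gibbsMeasure U c) ↔ Integrable fun x => gibbsDensity U c x * f x := by
  rw [gibbsMeasure, integrable_withDensity_iff_integrable_smul'
    (hU.continuous_gibbsDensity c).measurable.ennreal_ofReal
    (Eventually.of_forall fun _ => ENNReal.ofReal_lt_top)]
  simp only [ENNReal.toReal_ofReal (hU.gibbsDensity_pos hc _).le, smul_eq_mul]

theorem integral_gibbsMeasure {c : ℝ} (hc : 0 < c) (f : ℝ → ℝ) :
    ∫ x, f x ∂gibbsMeasure U c = ∫ x, gibbsDensity U c x * f x := by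
  rw [gibbsMeasure, integral_withDensity_eq_integral_toReal_smul
    (hU.continuous_gibbsDensity c).measurable.ennreal_ofReal
    (Eventually.of_forall fun _ => ENNReal.ofReal_lt_top)]
  simp only [ENNReal.toReal_ofReal (hU.gibbsDensity_pos hc _).le, smul_eq_mul]

theorem integrable_potential {c : ℝ} (hc : 0 < c) : Integrable U (gibbsMeasure U c) := by
  rw [hU.integrable_gibbsMeasure_iff hc]
  refine ((hU.integrable_pow 1 hc).div_const (∫ y, Real.exp (-c * U y))).congr
    (Eventually.of_forall fun x => ?_)
  simp only [gibbsDensity, pow_one]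
  ring

theorem integral_potential {c : ℝ} (hc : 0 < c) :
    ∫ x, U x ∂gibbsMeasure U c =
      (∫ x, U x ^ 1 * Real.exp (-c * U x)) / ∫ x, U x ^ 0 * Real.exp (-c * U x) := by
  rw [hU.integral_gibbsMeasure hc, ← integral_div]
  congr 1 with x
  simp only [gibbsDensity, pow_one, pow_zero, one_mul]
  ring

end IsConfining

noncomputable section

/-- The distribution function of a Gibbs measure. -/
def gibbsCDF (U : ℝ → ℝ) (c y : ℝ) : ℝ := ∫ x in Iic y, gibbsDensity U c x

/-- The flux `∫_{-∞}^y (U - ∫ U dμ_c) dμ_c`, the derivative of `-gibbsCDF U c y` in `c`. -/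
def gibbsFlux (U : ℝ → ℝ) (c y : ℝ) : ℝ :=
  ∫ x in Iic y, (U x - ∫ z, U z ∂gibbsMeasure U c) * gibbsDensity U c x

/-- The velocity field of the Gibbs measures parametrized by the inverse temperature. -/
def gibbsField (U : ℝ → ℝ) (c y : ℝ) : ℝ := gibbsFlux U c y / gibbsDensity U c y

end

namespace IsConfining

variable {U : ℝ → ℝ} (hU : IsConfining U)
include hU

omit hU in
theorem gibbsCDF_eq (c y : ℝ) : gibbsCDF U c y =
    (∫ x in Iic y, U x ^ 0 * Real.exp (-c * U x)) / ∫ x, U x ^ 0 * Real.exp (-c * U x) := by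
  simp only [gibbsCDF, gibbsDensity, pow_zero, one_mul]
  exact integral_div _ _

theorem gibbsFlux_eq {c : ℝ} (hc : 0 < c) (y : ℝ) : gibbsFlux U c y =
    (∫ x in Iic y, U x ^ 1 * Real.exp (-c * U x)) / (∫ x, U x ^ 0 * Real.exp (-c * U x)) -
      (∫ x, U x ^ 1 * Real.exp (-c * U x)) / (∫ x, U x ^ 0 * Real.exp (-c * U x)) *
        gibbsCDF U c y := by
  rw [gibbsFlux, hU.integral_potential hc]
  set m := (∫ x, U x ^ 1 * Real.exp (-c * U x)) / (∫ x, U x ^ 0 * Real.exp (-c * U x))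
  rw [gibbsCDF, ← integral_const_mul, ← integral_div, ← integral_sub]
  · congr 1 with x
    simp only [gibbsDensity, pow_zero, pow_one, one_mul]
    ring
  · exact ((hU.integrable_pow 1 hc).div_const _).integrableOn
  · exact ((hU.integrable_gibbsDensity hc).const_mul _).integrableOn

theorem integral_pow_zero_pos {c : ℝ} (hc : 0 < c) :
    0 < ∫ x, U x ^ 0 * Real.exp (-c * U x) := by
  simpa using hU.integral_exp_pos hc

theorem hasDerivAt_gibbsCDF_left {c : ℝ} (hc : 0 < c) (y : ℝ) :
    HasDerivAt (fun c => gibbsCDF U c y) (-gibbsFlux U c y) c := by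
  have h0 := (hU.integral_pow_zero_pos hc).ne'
  have hZ := hU.hasDerivAt_setIntegral_pow 0 univ hc
  simp only [setIntegral_univ] at hZ
  have h := (hU.hasDerivAt_setIntegral_pow 0 (Iic y) hc).div hZ h0
  simp_rw [gibbsCDF_eq]
  convert! h using 1
  rw [hU.gibbsFlux_eq hc, gibbsCDF_eq]
  simp only [zero_add]
  generalize (∫ x, U x ^ 0 * Real.exp (-c * U x)) = Z at h0
  generalize (∫ x in Iic y, U x ^ 0 * Real.exp (-c * U x)) = A
  generalize (∫ x in Iic y, U x ^ 1 * Real.exp (-c * U x)) = B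
  generalize (∫ x, U x ^ 1 * Real.exp (-c * U x)) = C
  field_simp
  ring

theorem hasDerivAt_gibbsCDF {c : ℝ} (hc : 0 < c) (y : ℝ) :
    HasDerivAt (gibbsCDF U c) (gibbsDensity U c y) y := by
  have h := (hU.hasDerivAt_integral_Iic_pow 0 hc y).div_const
    (∫ x, U x ^ 0 * Real.exp (-c * U x))
  have he : gibbsCDF U c = fun y => (∫ x in Iic y, U x ^ 0 * Real.exp (-c * U x)) /
    ∫ x, U x ^ 0 * Real.exp (-c * U x) := funext fun y => gibbsCDF_eq c y
  rw [he]
  convert! h using 1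
  simp [gibbsDensity]

theorem continuousAt_gibbsFlux {c : ℝ} (hc : 0 < c) (y : ℝ) :
    ContinuousAt (fun z : ℝ × ℝ => gibbsFlux U z.1 z.2) (c, y) := by
  have hpos : ∀ᶠ z : ℝ × ℝ in 𝓝 (c, y), 0 < z.1 :=
    continuous_fst.continuousAt.eventually (lt_mem_nhds hc)
  have hI := fun k => (hU.continuousAt_integral_pow k hc).comp_of_eq
    (continuousAt_fst (p := (c, y))) rfl
  have h0 := (hU.integral_pow_zero_pos hc).ne'
  have h := ((hU.continuousAt_integral_Iic_pow 1 hc y).div (hI 0) h0).sub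
    (((hI 1).div (hI 0) h0).mul ((hU.continuousAt_integral_Iic_pow 0 hc y).div (hI 0) h0))
  refine h.congr ?_
  filter_upwards [hpos] with z hz
  rw [hU.gibbsFlux_eq hz, gibbsCDF_eq]
  rfl

theorem continuousAt_gibbsField {c : ℝ} (hc : 0 < c) (y : ℝ) :
    ContinuousAt (fun z : ℝ × ℝ => gibbsField U z.1 z.2) (c, y) :=
  (hU.continuousAt_gibbsFlux hc y).div (hU.continuousAt_gibbsDensity hc y)
    (hU.gibbsDensity_pos hc y).ne'

/-- Both partial derivatives are jointly continuous, hence joint differentiability, as needed to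
invert the map in `y`. -/
theorem hasFDerivAt_gibbsCDF {c : ℝ} (hc : 0 < c) (y : ℝ) :
    HasFDerivAt (fun z : ℝ × ℝ => gibbsCDF U z.1 z.2)
      ((ContinuousLinearMap.toSpanSingleton ℝ (-gibbsFlux U c y)).coprod
        (ContinuousLinearMap.toSpanSingleton ℝ (gibbsDensity U c y))) (c, y) := by
  have hpos : ∀ᶠ z : ℝ × ℝ in 𝓝 (c, y), 0 < z.1 :=
    continuous_fst.continuousAt.eventually (lt_mem_nhds hc)
  have hspan : Continuous fun a : ℝ => ContinuousLinearMap.toSpanSingleton ℝ a :=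
    (ContinuousLinearMap.toSpanSingletonLE ℝ ℝ ℝ).toLinearMap.continuous_of_finiteDimensional
  exact (hasStrictFDerivAt_uncurry_coprod (u := (c, y)) (f := gibbsCDF U)
    (f₁ := fun c y => ContinuousLinearMap.toSpanSingleton ℝ (-gibbsFlux U c y))
    (f₂ := fun c y => ContinuousLinearMap.toSpanSingleton ℝ (gibbsDensity U c y))
    (hpos.mono fun z hz => (hU.hasDerivAt_gibbsCDF_left hz z.2).hasFDerivAt)
    (hpos.mono fun z hz => (hU.hasDerivAt_gibbsCDF hz z.2).hasFDerivAt)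
    (hspan.continuousAt.comp (hU.continuousAt_gibbsFlux hc y).neg)
    (hspan.continuousAt.comp (hU.continuousAt_gibbsDensity hc y))).hasFDerivAt

theorem strictMono_gibbsCDF {c : ℝ} (hc : 0 < c) : StrictMono (gibbsCDF U c) :=
  strictMono_of_hasDerivAt_pos (hU.hasDerivAt_gibbsCDF hc) (hU.gibbsDensity_pos hc)

theorem gibbsMeasure_Iic {c : ℝ} (hc : 0 < c) (y : ℝ) :
    gibbsMeasure U c (Iic y) = ENNReal.ofReal (gibbsCDF U c y) :=
  hU.gibbsMeasure_apply hc measurableSet_Iic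

theorem gibbsCDF_eq_cdf {c : ℝ} (hc : 0 < c) :
    gibbsCDF U c = ProbabilityTheory.cdf (gibbsMeasure U c) := by
  have := hU.isProbabilityMeasure_gibbsMeasure hc
  ext y
  rw [ProbabilityTheory.cdf_eq_real, measureReal_def, hU.gibbsMeasure_Iic hc,
    ENNReal.toReal_ofReal]
  exact integral_nonneg fun x => (hU.gibbsDensity_pos hc x).le

theorem gibbsCDF_mem_Ioo {c : ℝ} (hc : 0 < c) (y : ℝ) : gibbsCDF U c y ∈ Ioo (0 : ℝ) 1 := by
  have hm := hU.strictMono_gibbsCDF hc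
  have h1 := hm (show y - 1 < y by linarith)
  have h2 := hm (show y < y + 1 by linarith)
  rw [hU.gibbsCDF_eq_cdf hc] at h1 h2 ⊢
  exact ⟨(ProbabilityTheory.cdf_nonneg _ _).trans_lt h1,
    h2.trans_le (ProbabilityTheory.cdf_le_one _ _)⟩

theorem exists_gibbsCDF_eq {c : ℝ} (hc : 0 < c) {u : ℝ} (hu : u ∈ Ioo (0 : ℝ) 1) :
    ∃ y, gibbsCDF U c y = u := by
  refine mem_range_of_exists_le_of_exists_ge (continuous_iff_continuousAt.2 fun y =>
    (hU.hasDerivAt_gibbsCDF hc y).continuousAt) ?_ ?_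
  · rw [hU.gibbsCDF_eq_cdf hc]
    exact ((ProbabilityTheory.tendsto_cdf_atBot _).eventually (gt_mem_nhds hu.1)).exists.imp
      fun _ => le_of_lt
  · rw [hU.gibbsCDF_eq_cdf hc]
    exact ((ProbabilityTheory.tendsto_cdf_atTop _).eventually (lt_mem_nhds hu.2)).exists.imp
      fun _ => le_of_lt

end IsConfining

/-! ### Quantile functions of Gibbs measures -/

/-- The quantile function of a Gibbs measure. -/
noncomputable def gibbsQuantile (U : ℝ → ℝ) (c u : ℝ) : ℝ := Function.invFun (gibbsCDF U c) u

namespace IsConfining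

variable {U : ℝ → ℝ} (hU : IsConfining U)
include hU

theorem gibbsCDF_gibbsQuantile {c : ℝ} (hc : 0 < c) {u : ℝ} (hu : u ∈ Ioo (0 : ℝ) 1) :
    gibbsCDF U c (gibbsQuantile U c u) = u :=
  Function.invFun_eq (hU.exists_gibbsCDF_eq hc hu)

omit hU in
theorem eventually_pos_and_mem_Ioo {c u : ℝ} (hc : 0 < c) (hu : u ∈ Ioo (0 : ℝ) 1) :
    ∀ᶠ z : ℝ × ℝ in 𝓝 (c, u), 0 < z.1 ∧ z.2 ∈ Ioo (0 : ℝ) 1 :=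
  (continuous_fst.continuousAt.eventually (lt_mem_nhds hc)).and
    (continuous_snd.continuousAt.eventually (Ioo_mem_nhds hu.1 hu.2))

/-- By strict monotonicity, `a < Q_c u` means `F_c a < u`, an open condition on `(c, u)` since `F_c
a` is continuous in `c`; likewise for `>`. -/
theorem continuousAt_gibbsQuantile {c u : ℝ} (hc : 0 < c) (hu : u ∈ Ioo (0 : ℝ) 1) :
    ContinuousAt (fun z : ℝ × ℝ => gibbsQuantile U z.1 z.2) (c, u) := by
  have hcont : ∀ y, ContinuousAt (fun z : ℝ × ℝ => gibbsCDF U z.1 y - z.2) (c, u) := fun y =>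
    ((hU.hasDerivAt_gibbsCDF_left hc y).continuousAt.comp_of_eq continuousAt_fst rfl).sub
      continuousAt_snd
  have hev := eventually_pos_and_mem_Ioo hc hu
  refine tendsto_order.2 ⟨fun a ha => ?_, fun a ha => ?_⟩
  · have h : gibbsCDF U c a - u < 0 := by
      have := hU.strictMono_gibbsCDF hc ha
      simp only [hU.gibbsCDF_gibbsQuantile hc hu] at this
      linarith
    filter_upwards [hev, (hcont a).eventually (gt_mem_nhds h)] with z hz hz'
    rw [← (hU.strictMono_gibbsCDF hz.1).lt_iff_lt, hU.gibbsCDF_gibbsQuantile hz.1 hz.2]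
    linarith
  · have h : 0 < gibbsCDF U c a - u := by
      have := hU.strictMono_gibbsCDF hc ha
      simp only [hU.gibbsCDF_gibbsQuantile hc hu] at this
      linarith
    filter_upwards [hev, (hcont a).eventually (lt_mem_nhds h)] with z hz hz'
    rw [← (hU.strictMono_gibbsCDF hz.1).lt_iff_lt, hU.gibbsCDF_gibbsQuantile hz.1 hz.2]
    linarith

/-- The quantile functions are the flow of the velocity field. -/
theorem hasDerivAt_gibbsQuantile {c u : ℝ} (hc : 0 < c) (hu : u ∈ Ioo (0 : ℝ) 1) :
    HasDerivAt (fun c => gibbsQuantile U c u) (gibbsField U c (gibbsQuantile U c u)) c := by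
  set y := gibbsQuantile U c u with hy
  have hπ := (hU.gibbsDensity_pos hc y).ne'
  -- The derivative of `(c, y) ↦ (c, F_c y)` is triangular with diagonal `(1, π)`, hence invertible;
  -- its inverse sends `(1, 0)` to `(1, flux / π)`.
  let e : (ℝ × ℝ) ≃L[ℝ] ℝ × ℝ := (ContinuousLinearEquiv.refl ℝ ℝ).skewProd
    (ContinuousLinearEquiv.unitsEquivAut ℝ (Units.mk0 _ hπ))
    (ContinuousLinearMap.toSpanSingleton ℝ (-gibbsFlux U c y))
  have hF : HasFDerivAt (fun z : ℝ × ℝ => (z.1, gibbsCDF U z.1 z.2)) (e : ℝ × ℝ →L[ℝ] ℝ × ℝ)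
      (c, y) := by
    convert! hasFDerivAt_fst.prodMk (hU.hasFDerivAt_gibbsCDF hc y) using 1
    ext <;> simp [e, ContinuousLinearEquiv.skewProd_apply]
  have hg : ContinuousAt (fun z : ℝ × ℝ => (z.1, gibbsQuantile U z.1 z.2)) (c, u) :=
    continuousAt_fst.prodMk (hU.continuousAt_gibbsQuantile hc hu)
  have hinv : ∀ᶠ z : ℝ × ℝ in 𝓝 (c, u),
      (fun z : ℝ × ℝ => (z.1, gibbsCDF U z.1 z.2)) ((z.1, gibbsQuantile U z.1 z.2)) = z := by
    filter_upwards [eventually_pos_and_mem_Ioo hc hu] with z hz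
    simp only [hU.gibbsCDF_gibbsQuantile hz.1 hz.2]
  have h1 := HasFDerivAt.of_local_left_inverse hg hF hinv
  have h2 : HasDerivAt (fun c : ℝ => (c, u)) (1, 0) c :=
    (hasDerivAt_id c).prodMk (hasDerivAt_const c u)
  have h3 := (hasFDerivAt_snd.comp c (h1.comp c h2.hasFDerivAt)).hasDerivAt
  convert! h3 using 1
  simp [e, gibbsField, ContinuousLinearEquiv.skewProd_symm_apply, div_eq_mul_inv]

theorem aemeasurable_gibbsQuantile {c : ℝ} (hc : 0 < c) :
    AEMeasurable (gibbsQuantile U c) (volume.restrict (Ioo 0 1)) := by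
  refine ContinuousOn.aemeasurable (fun u hu => ContinuousAt.continuousWithinAt ?_)
    measurableSet_Ioo
  exact (hU.continuousAt_gibbsQuantile hc hu).comp_of_eq
    (f := fun u => (c, u)) (by fun_prop) rfl

/-- On `(0, 1)`, the condition `Q_c u ≤ y` cuts out `(0, F_c y]`, because `F_c y < 1`. -/
theorem map_gibbsQuantile {c : ℝ} (hc : 0 < c) :
    (volume.restrict (Ioo 0 1)).map (gibbsQuantile U c) = gibbsMeasure U c := by
  have hprob := hU.isProbabilityMeasure_gibbsMeasure hc
  refine (Measure.ext_of_Iic _ _ fun y => ?_).symm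
  rw [Measure.map_apply_of_aemeasurable (hU.aemeasurable_gibbsQuantile hc) measurableSet_Iic,
    hU.gibbsMeasure_Iic hc, Measure.restrict_apply' measurableSet_Ioo]
  have hmem := hU.gibbsCDF_mem_Ioo hc y
  have hset : gibbsQuantile U c ⁻¹' Iic y ∩ Ioo 0 1 = Ioc 0 (gibbsCDF U c y) := by
    ext u
    constructor
    · rintro ⟨h, hu⟩
      refine ⟨hu.1, ?_⟩
      rw [← hU.gibbsCDF_gibbsQuantile hc hu]
      exact (hU.strictMono_gibbsCDF hc).monotone h
    · intro hu
      have hu' : u ∈ Ioo (0 : ℝ) 1 := ⟨hu.1, hu.2.trans_lt hmem.2⟩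
      refine ⟨?_, hu'⟩
      rw [mem_preimage, mem_Iic, ← (hU.strictMono_gibbsCDF hc).le_iff_le,
        hU.gibbsCDF_gibbsQuantile hc hu']
      exact hu.2
  rw [hset, Real.volume_Ioc, sub_zero]

end IsConfining

/-! ### Growth of the velocity field -/

/-- The function `y ↦ h y + α ∫_x^y h` is nonincreasing on `[x, ∞)`: compare its value at `x` with
its limit, dropping `h y ≥ 0`. -/
theorem mul_integral_Ioi_le {h h' : ℝ → ℝ} {α x : ℝ} (h0 : ∀ y, 0 ≤ h y) (hint : Integrable h)
    (hder : ∀ y, HasDerivAt h (h' y) y) (hle : ∀ y, x < y → α * h y ≤ -h' y) :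
    α * ∫ y in Ioi x, h y ≤ h x := by
  have hcont : Continuous h := continuous_iff_continuousAt.2 fun y => (hder y).continuousAt
  have hg : ∀ y, HasDerivAt (fun y => h y + α * ∫ z in x..y, h z) (h' y + α * h y) y := fun y =>
    (hder y).add ((intervalIntegral.integral_hasDerivAt_right (hcont.intervalIntegrable x y)
      (hcont.stronglyMeasurableAtFilter _ _) hcont.continuousAt).const_mul α)
  have hanti : AntitoneOn (fun y => h y + α * ∫ z in x..y, h z) (Ici x) := by
    refine antitoneOn_of_deriv_nonpos (convex_Ici x)
      (fun y _ => (hg y).continuousAt.continuousWithinAt)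
      (fun y _ => (hg y).differentiableAt.differentiableWithinAt) fun y hy => ?_
    rw [interior_Ici] at hy
    rw [(hg y).deriv]
    linarith [hle y hy]
  refine le_of_tendsto ((intervalIntegral_tendsto_integral_Ioi x hint.integrableOn
    tendsto_id).const_mul α) ?_
  filter_upwards [eventually_ge_atTop x] with y hy
  have := hanti self_mem_Ici hy hy
  simp only [intervalIntegral.integral_same, mul_zero, add_zero, id] at this ⊢
  linarith [h0 y]

theorem mul_integral_Iic_le {h h' : ℝ → ℝ} {α x : ℝ} (h0 : ∀ y, 0 ≤ h y) (hint : Integrable h)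
    (hder : ∀ y, HasDerivAt h (h' y) y) (hle : ∀ y, y < x → α * h y ≤ h' y) :
    α * ∫ y in Iic x, h y ≤ h x := by
  have := mul_integral_Ioi_le (h := fun y => h (-y)) (h' := fun y => -h' (-y)) (α := α) (x := -x)
    (fun y => h0 _) hint.comp_neg
    (fun y => by
      have h1 := (hder (-y)).comp y (hasDerivAt_neg y)
      rwa [mul_neg_one] at h1)
    (fun y hy => by rw [neg_neg]; exact hle _ (by linarith))
  rwa [integral_comp_neg_Ioi, neg_neg] at this

/-- Multiply by `u`. Since `c₀ u > 1`, this forces `v ≥ 0`, so replacing `c₀` by a larger `c` only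
helps. It is used with `u = U` and `v = ±U'`, and carries the condition at `β 0` to all lower
temperatures. -/
theorem mul_le_of_gradient {α u v c₀ c : ℝ} (hα : 0 < α) (hu : 0 < u) (hcu : 1 < c₀ * u)
    (hc : c₀ ≤ c) (h : α ≤ c₀ * v - v / u) : α * u ≤ v * (c * u - 1) := by
  have h1 : α * u ≤ v * (c₀ * u - 1) := by
    calc α * u ≤ (c₀ * v - v / u) * u := by gcongr
      _ = v * (c₀ * u - 1) := by field_simp
  have hv : 0 ≤ v := by
    by_contra! hv
    nlinarith [mul_pos hα hu]
  nlinarith [mul_nonneg hv (mul_nonneg (sub_nonneg.2 hc) hu.le)]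

namespace IsConfining

variable {U : ℝ → ℝ} (hU : IsConfining U)
include hU

theorem integral_potential_nonneg (c : ℝ) : 0 ≤ ∫ z, U z ∂gibbsMeasure U c :=
  integral_nonneg hU.nonneg

theorem integral_exp_anti {a b : ℝ} (ha : 0 < a) (hab : a ≤ b) :
    ∫ x, Real.exp (-b * U x) ≤ ∫ x, Real.exp (-a * U x) := by
  refine integral_mono (hU.integrable_exp (ha.trans_le hab)) (hU.integrable_exp ha) fun x => ?_
  have := hU.nonneg x
  simp only
  gcongr

theorem integral_potential_le {a b c : ℝ} (ha : 0 < a) (hc : c ∈ Icc a b) :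
    ∫ z, U z ∂gibbsMeasure U c ≤
      (∫ x, U x ^ 1 * Real.exp (-a * U x)) / ∫ x, Real.exp (-b * U x) := by
  have hc0 : 0 < c := ha.trans_le hc.1
  rw [hU.integral_potential hc0]
  simp only [pow_zero, one_mul]
  have h1 := hU.integral_exp_pos (hc0.trans_le hc.2)
  refine div_le_div₀ (integral_nonneg fun x => ?_) (integral_mono (hU.integrable_pow 1 hc0)
    (hU.integrable_pow 1 ha) fun x => ?_) h1 (hU.integral_exp_anti hc0 hc.2)
  · have := hU.nonneg x
    positivity
  · have := hU.nonneg x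
    have := hc.1
    simp only
    gcongr

theorem integrable_mul_gibbsDensity {c : ℝ} (hc : 0 < c) :
    Integrable fun x => U x * gibbsDensity U c x := by
  simpa only [mul_comm] using (hU.integrable_gibbsMeasure_iff hc).1 (hU.integrable_potential hc)

omit hU in
theorem hasDerivAt_mul_gibbsDensity (hd : Differentiable ℝ U) (c y : ℝ) :
    HasDerivAt (fun x => U x * gibbsDensity U c x)
      (-(deriv U y * (c * U y - 1)) * gibbsDensity U c y) y := by
  have hUd := (hd y).hasDerivAt
  have h1 : HasDerivAt (gibbsDensity U c) (-c * deriv U y * gibbsDensity U c y) y := by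
    convert! ((hUd.const_mul (-c)).exp).div_const (∫ z, Real.exp (-c * U z)) using 1
    simp only [gibbsDensity]
    ring
  convert! hUd.mul h1 using 1
  ring

/-- The fluctuation `U - ∫ U dμ_c` has mean zero, so on the right only the right tail need be
estimated. -/
theorem gibbsFlux_eq_neg {c : ℝ} (hc : 0 < c) (y : ℝ) : gibbsFlux U c y =
    -∫ x in Ioi y, (U x - ∫ z, U z ∂gibbsMeasure U c) * gibbsDensity U c x := by
  have hint : Integrable fun x => (U x - ∫ z, U z ∂gibbsMeasure U c) * gibbsDensity U c x := by
    simp_rw [sub_mul]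
    exact (hU.integrable_mul_gibbsDensity hc).sub ((hU.integrable_gibbsDensity hc).const_mul _)
  have h := intervalIntegral.integral_Iic_add_Ioi (b := y) hint.integrableOn hint.integrableOn
  have h0 : ∫ x, (U x - ∫ z, U z ∂gibbsMeasure U c) * gibbsDensity U c x = 0 := by
    simp_rw [sub_mul]
    rw [integral_sub (hU.integrable_mul_gibbsDensity hc)
      ((hU.integrable_gibbsDensity hc).const_mul _), integral_const_mul,
      hU.integral_gibbsDensity hc, hU.integral_gibbsMeasure hc, mul_one, sub_eq_zero]
    simp only [mul_comm]
  rw [gibbsFlux]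
  linarith

theorem setIntegral_fluctuation_mem {c : ℝ} (hc : 0 < c) {S : Set ℝ} (hS : MeasurableSet S)
    (h : ∀ x ∈ S, ∫ z, U z ∂gibbsMeasure U c ≤ U x) :
    (∫ x in S, (U x - ∫ z, U z ∂gibbsMeasure U c) * gibbsDensity U c x) ∈
      Icc 0 (∫ x in S, U x * gibbsDensity U c x) := by
  have hm := hU.integral_potential_nonneg c
  constructor
  · exact setIntegral_nonneg hS fun x hx =>
      mul_nonneg (sub_nonneg.2 (h x hx)) (hU.gibbsDensity_pos hc x).le
  · refine integral_mono ?_ (hU.integrable_mul_gibbsDensity hc).integrableOn fun x => ?_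
    · simp_rw [sub_mul]
      exact ((hU.integrable_mul_gibbsDensity hc).sub
        ((hU.integrable_gibbsDensity hc).const_mul _)).integrableOn
    · exact mul_le_mul_of_nonneg_right (by linarith) (hU.gibbsDensity_pos hc x).le

theorem exists_le_potential (M : ℝ) : ∃ R > 0, ∀ x, R ≤ |x| → M ≤ U x := by
  obtain ⟨a, ha, b, hb⟩ := hU.quadratic
  have hR : (0 : ℝ) < 1 + (|M| + |b|) / a := by positivity
  refine ⟨_, hR, fun x hx => ?_⟩
  have h1 : (1 + (|M| + |b|) / a) ≤ x ^ 2 := by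
    rw [← sq_abs]
    have h2 : 1 ≤ 1 + (|M| + |b|) / a := by
      have : 0 ≤ (|M| + |b|) / a := by positivity
      linarith
    nlinarith
  have h2 : a + (|M| + |b|) ≤ a * x ^ 2 := by
    calc a + (|M| + |b|) = a * (1 + (|M| + |b|) / a) := by field_simp
      _ ≤ _ := by gcongr
  linarith [hb x, le_abs_self M, le_abs_self b]

/-- In the tails, `h = U π_c` decreases outwards at rate at least `α h`, so the flux is at most `h /
α` and the field at most `U / α`. In between, joint continuity on a compact set suffices. -/
theorem exists_abs_gibbsField_le (hd : Differentiable ℝ U) {a b : ℝ} (ha : 0 < a)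
    (hgrad : ∃ R : ℝ, ∃ α > 0, ∀ x : ℝ, R < |x| →
      α * |x| ≤ x * (a * deriv U x - deriv U x / U x)) :
    ∃ C > 0, ∀ c ∈ Icc a b, ∀ x, |gibbsField U c x| ≤ C * (1 + U x) := by
  obtain ⟨R, α, hα, hgrad⟩ := hgrad
  -- The threshold `2 / a` ensures `a U > 1`; the other one dominates `∫ U dμ_c` for every `c` in
  -- `[a, b]`.
  obtain ⟨R', hR', hlarge⟩ := hU.exists_le_potential (max (2 / a)
    ((∫ x, U x ^ 1 * Real.exp (-a * U x)) / ∫ x, Real.exp (-b * U x)))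
  set r := max R R' with hr
  have hr0 : 0 < r := lt_max_of_lt_right hR'
  have hcont : ContinuousOn (fun z : ℝ × ℝ => gibbsField U z.1 z.2) (Icc a b ×ˢ Icc (-r) r) :=
    fun z hz => (hU.continuousAt_gibbsField (ha.trans_le hz.1.1) z.2).continuousWithinAt
  obtain ⟨K, hK⟩ := (isCompact_Icc.prod isCompact_Icc).exists_bound_of_continuousOn hcont
  have hC : 0 < max (1 / α) K := lt_max_of_lt_left (by positivity)
  refine ⟨_, hC, fun c hc x => ?_⟩
  have hc0 : 0 < c := ha.trans_le hc.1
  have hm : ∀ y, r ≤ |y| → ∫ z, U z ∂gibbsMeasure U c ≤ U y := fun y hy =>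
    (hU.integral_potential_le ha hc).trans
      ((le_max_right _ _).trans (hlarge y ((le_max_right _ _).trans hy)))
  have hbig : ∀ y, r ≤ |y| → 0 < U y ∧ 1 < a * U y := fun y hy => by
    have h1 : 2 / a ≤ U y := (le_max_left _ _).trans (hlarge y ((le_max_right _ _).trans hy))
    have h2 : 0 < 2 / a := by positivity
    rw [div_le_iff₀ ha] at h1
    exact ⟨h2.trans_le (by rwa [div_le_iff₀ ha]), by linarith⟩
  have hright : ∀ y, r < y → α * U y ≤ deriv U y * (c * U y - 1) := fun y hy => by
    have hy0 : 0 < y := hr0.trans hy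
    have hy' : |y| = y := abs_of_pos hy0
    obtain ⟨h1, h2⟩ := hbig y (by rw [hy']; exact hy.le)
    refine mul_le_of_gradient hα h1 h2 hc.1 ?_
    have := hgrad y (by rw [hy']; exact (le_max_left _ _).trans_lt hy)
    rw [hy', mul_comm] at this
    exact le_of_mul_le_mul_left this hy0
  have hleft : ∀ y, y < -r → α * U y ≤ -deriv U y * (c * U y - 1) := fun y hy => by
    have hy0 : y < 0 := by linarith
    have hy' : |y| = -y := abs_of_neg hy0
    obtain ⟨h1, h2⟩ := hbig y (by rw [hy']; linarith)
    refine mul_le_of_gradient hα h1 h2 hc.1 ?_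
    have := hgrad y (by rw [hy']; exact (le_max_left _ _).trans_lt (by linarith))
    rw [hy'] at this
    refine le_of_mul_le_mul_left ?_ (neg_pos.2 hy0)
    calc -y * α = α * -y := mul_comm _ _
      _ ≤ y * (a * deriv U y - deriv U y / U y) := this
      _ = _ := by ring
  have hπ := hU.gibbsDensity_pos hc0
  have h0 : ∀ y, 0 ≤ U y * gibbsDensity U c y := fun y => mul_nonneg (hU.nonneg y) (hπ y).le
  have hUx := hU.nonneg x
  have hfin : ∀ I, α * I ≤ U x * gibbsDensity U c x → |gibbsFlux U c x| ≤ I →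
      |gibbsField U c x| ≤ max (1 / α) K * (1 + U x) := by
    intro I hI hflux
    rw [gibbsField, abs_div, abs_of_pos (hπ x), div_le_iff₀ (hπ x)]
    calc |gibbsFlux U c x| ≤ I := hflux
      _ ≤ 1 / α * (U x * gibbsDensity U c x) := by
        rw [div_mul_eq_mul_div, le_div_iff₀ hα]; linarith
      _ ≤ max (1 / α) K * ((1 + U x) * gibbsDensity U c x) := by
        have := hπ x
        gcongr
        · exact le_max_left _ _
        · linarith
      _ = _ := by ring
  rcases le_or_gt r x with hx | hx
  · have hI := mul_integral_Ioi_le h0 (hU.integrable_mul_gibbsDensity hc0)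
      (hasDerivAt_mul_gibbsDensity hd c) (α := α) (x := x) (fun y hy => by
        rw [neg_mul, neg_neg, ← mul_assoc]
        exact mul_le_mul_of_nonneg_right (hright y (hx.trans_lt hy)) (hπ y).le)
    refine hfin _ hI ?_
    have := hU.setIntegral_fluctuation_mem hc0 (measurableSet_Ioi (a := x)) fun y hy =>
      hm y ((hx.trans (le_of_lt hy)).trans (le_abs_self y))
    rw [hU.gibbsFlux_eq_neg hc0, abs_neg, abs_of_nonneg this.1]
    exact this.2
  rcases le_or_gt x (-r) with hx' | hx'
  · have hI := mul_integral_Iic_le h0 (hU.integrable_mul_gibbsDensity hc0)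
      (hasDerivAt_mul_gibbsDensity hd c) (α := α) (x := x) (fun y hy => by
        rw [← mul_assoc, ← neg_mul]
        exact mul_le_mul_of_nonneg_right (hleft y (hy.trans_le hx')) (hπ y).le)
    refine hfin _ hI ?_
    have := hU.setIntegral_fluctuation_mem hc0 (measurableSet_Iic (a := x)) fun y hy =>
      hm y ((by linarith [mem_Iic.1 hy] : r ≤ -y).trans (neg_le_abs y))
    rw [gibbsFlux, abs_of_nonneg this.1]
    exact this.2
  · calc |gibbsField U c x| ≤ K := hK (c, x) ⟨hc, hx'.le, hx.le⟩
      _ ≤ max (1 / α) K * 1 := by rw [mul_one]; exact le_max_right _ _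
      _ ≤ _ := by gcongr; linarith

/-! ### Uniform moment bounds -/

/-- Functions which grow at most like the potential are in `L^p`, locally uniformly in the inverse
temperature. -/
theorem exists_lintegral_le {p a b C : ℝ} (hp : 1 ≤ p) (ha : 0 < a) (hC : 0 ≤ C) :
    ∃ M ≥ 0, ∀ c ∈ Icc a b, ∀ f : ℝ → ℝ, (∀ x, |f x| ≤ C * (1 + U x)) →
      ∫⁻ x, ‖f x‖ₑ ^ p ∂gibbsMeasure U c ≤ ENNReal.ofReal M ^ p := by
  have hp0 : 0 < p := by linarith
  -- For `c` in `[a, b]`, the density is at most `exp (-a U)` over the partition function at `b`, as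
  -- both exponentials decrease in `c`.
  set N := ∫ x, C ^ p * ((1 + U x) ^ p * Real.exp (-a * U x)) / ∫ y, Real.exp (-b * U y) with hN
  refine ⟨max N 0 ^ (1 / p), by positivity, fun c hc f hf => ?_⟩
  have hc0 : 0 < c := ha.trans_le hc.1
  rw [ENNReal.ofReal_rpow_of_nonneg (by positivity) hp0.le, ← Real.rpow_mul (le_max_right _ _),
    one_div_mul_cancel hp0.ne', Real.rpow_one]
  refine le_trans ?_ (ENNReal.ofReal_le_ofReal (le_max_left N 0))
  have hb := hU.integral_exp_pos (hc0.trans_le hc.2)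
  have hnn : ∀ x, 0 ≤ C ^ p * ((1 + U x) ^ p * Real.exp (-a * U x)) / ∫ y, Real.exp (-b * U y) :=
    fun x => by
      have := hU.nonneg x
      positivity
  rw [hN, ofReal_integral_eq_lintegral_ofReal
    (((hU.integrable_one_add_rpow hp ha).const_mul _).div_const _) (Eventually.of_forall hnn)]
  have hcont := hU.continuous
  have hmeas : Measurable fun x => ENNReal.ofReal (C * (1 + U x)) ^ p := by fun_prop
  calc ∫⁻ x, ‖f x‖ₑ ^ p ∂gibbsMeasure U c
      ≤ ∫⁻ x, ENNReal.ofReal (C * (1 + U x)) ^ p ∂gibbsMeasure U c := by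
        gcongr with x
        rw [Real.enorm_eq_ofReal_abs]
        exact ENNReal.ofReal_le_ofReal (hf x)
    _ = ∫⁻ x, ENNReal.ofReal (gibbsDensity U c x) * ENNReal.ofReal (C * (1 + U x)) ^ p := by
        rw [gibbsMeasure, lintegral_withDensity_eq_lintegral_mul _
          (hU.continuous_gibbsDensity c).measurable.ennreal_ofReal hmeas]
        rfl
    _ ≤ _ := by
        refine lintegral_mono fun x => ?_
        have h0 := hU.nonneg x
        rw [ENNReal.ofReal_rpow_of_nonneg (by positivity) hp0.le,
          ← ENNReal.ofReal_mul (hU.gibbsDensity_pos hc0 x).le]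
        refine ENNReal.ofReal_le_ofReal ?_
        have h1 : gibbsDensity U c x ≤ Real.exp (-a * U x) / ∫ y, Real.exp (-b * U y) := by
          have := hU.integral_exp_anti hc0 hc.2
          have := hc.1
          unfold gibbsDensity
          gcongr
        calc gibbsDensity U c x * (C * (1 + U x)) ^ p
            ≤ Real.exp (-a * U x) / (∫ y, Real.exp (-b * U y)) * (C * (1 + U x)) ^ p := by gcongr
          _ = _ := by rw [Real.mul_rpow hC (by positivity)]; ring

theorem hasFiniteMoment_gibbsMeasure {p c : ℝ} (hp : 1 ≤ p) (hc : 0 < c) :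
    HasFiniteMoment p (gibbsMeasure U c) := by
  obtain ⟨a, ha, b, hb⟩ := hU.quadratic
  -- This constant comes from `|x| ≤ 1 + x ^ 2` and `a x ^ 2 ≤ U x + b`.
  have hC : 0 ≤ 1 + (1 + |b|) / a := by positivity
  obtain ⟨M, -, hM⟩ := hU.exists_lintegral_le (b := c) hp hc hC
  refine ⟨hU.isProbabilityMeasure_gibbsMeasure hc, 0, ?_⟩
  have h := hM c ⟨le_rfl, le_rfl⟩ (fun x => x) fun x => ?_
  · simp only [edist_zero_right]
    exact h.trans_lt (ENNReal.rpow_lt_top_of_nonneg (by linarith) ENNReal.ofReal_ne_top)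
  · have h0 := hU.nonneg x
    have h1 : |x| ≤ 1 + x ^ 2 := by nlinarith [sq_abs x, sq_nonneg (|x| - 1), abs_nonneg x]
    have h2 : x ^ 2 ≤ (U x + |b|) / a := by
      rw [le_div_iff₀ ha]; linarith [hb x, le_abs_self b]
    have h3 : (U x + |b|) / a ≤ (1 + |b|) / a * (1 + U x) := by
      rw [div_mul_eq_mul_div]
      gcongr
      nlinarith [mul_nonneg (abs_nonneg b) h0]
    nlinarith

end IsConfining

/-! ### Wasserstein estimates along the quantile flow. -/

/-- Hölder's inequality on an interval of length `b - a`. -/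
theorem enorm_setIntegral_rpow_le {f : ℝ → ℝ} {p a b : ℝ} (hp : 1 ≤ p)
    (hf : AEStronglyMeasurable f (volume.restrict (Ioc a b))) :
    ‖∫ x in Ioc a b, f x‖ₑ ^ p ≤
      ENNReal.ofReal (b - a) ^ (p - 1) * ∫⁻ x in Ioc a b, ‖f x‖ₑ ^ p := by
  have hp0 : 0 < p := by linarith
  have h := eLpNorm'_le_eLpNorm'_mul_rpow_measure_univ one_pos hp hf
  simp only [eLpNorm', ENNReal.rpow_one, div_one, Measure.restrict_apply_univ,
    Real.volume_Ioc] at h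
  calc ‖∫ x in Ioc a b, f x‖ₑ ^ p ≤ ((∫⁻ x in Ioc a b, ‖f x‖ₑ ^ p) ^ (1 / p) *
        ENNReal.ofReal (b - a) ^ (1 - 1 / p)) ^ p := by
        gcongr
        exact (enorm_integral_le_lintegral_enorm _).trans h
    _ = _ := by
        rw [ENNReal.mul_rpow_of_nonneg _ _ hp0.le, ← ENNReal.rpow_mul, ← ENNReal.rpow_mul,
          one_div_mul_cancel hp0.ne', ENNReal.rpow_one, mul_comm, sub_mul, one_mul,
          one_div_mul_cancel hp0.ne']

namespace IsConfining

variable {U : ℝ → ℝ} (hU : IsConfining U)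
include hU

theorem continuous_gibbsField {c : ℝ} (hc : 0 < c) : Continuous (gibbsField U c) :=
  continuous_iff_continuousAt.2 fun y => (hU.continuousAt_gibbsField hc y).comp_of_eq
    (f := fun y => (c, y)) (by fun_prop) rfl

theorem continuousOn_gibbsField_gibbsQuantile :
    ContinuousOn (fun z : ℝ × ℝ => gibbsField U z.2 (gibbsQuantile U z.2 z.1))
      (Ioo 0 1 ×ˢ Ioi 0) := fun z hz => by
  have h : ContinuousAt (fun z : ℝ × ℝ => (z.2, gibbsQuantile U z.2 z.1)) z :=
    continuousAt_snd.prodMk ((hU.continuousAt_gibbsQuantile hz.2 hz.1).comp_of_eq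
      (f := fun z : ℝ × ℝ => (z.2, z.1)) (by fun_prop) rfl)
  exact ((hU.continuousAt_gibbsField hz.2 _).comp_of_eq h rfl).continuousWithinAt

theorem edist_gibbsQuantile_rpow_le {p a b u : ℝ} (hp : 1 ≤ p) (ha : 0 < a) (hab : a ≤ b)
    (hu : u ∈ Ioo (0 : ℝ) 1) :
    edist (gibbsQuantile U a u) (gibbsQuantile U b u) ^ p ≤ ENNReal.ofReal (b - a) ^ (p - 1) *
      ∫⁻ c in Ioc a b, ‖gibbsField U c (gibbsQuantile U c u)‖ₑ ^ p := by
  have hcont : ContinuousOn (fun c => gibbsField U c (gibbsQuantile U c u)) (Icc a b) :=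
    hU.continuousOn_gibbsField_gibbsQuantile.comp (f := fun c => (u, c)) (by fun_prop)
      fun c hc => ⟨hu, ha.trans_le hc.1⟩
  have h : ∫ c in Ioc a b, gibbsField U c (gibbsQuantile U c u) =
      gibbsQuantile U b u - gibbsQuantile U a u := by
    rw [← intervalIntegral.integral_of_le hab]
    refine intervalIntegral.integral_eq_sub_of_hasDerivAt
      (f := fun c => gibbsQuantile U c u) (fun c hc => ?_) ?_
    · rw [uIcc_of_le hab] at hc
      exact hU.hasDerivAt_gibbsQuantile (ha.trans_le hc.1) hu
    · rw [← uIcc_of_le hab] at hcont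
      exact hcont.intervalIntegrable
  rw [edist_comm, edist_eq_enorm_sub, ← h]
  exact enorm_setIntegral_rpow_le hp
    ((hcont.mono Ioc_subset_Icc_self).aestronglyMeasurable measurableSet_Ioc)

/-- Couple by equal quantiles. After Tonelli, the integral over `u` at fixed `c` is the `p`-th power
of the `L^p(μ_c)` norm of the field, by `map_gibbsQuantile`. -/
theorem wasserstein_gibbsMeasure_le {p a b M : ℝ} (hp : 1 ≤ p) (ha : 0 < a) (hab : a ≤ b)
    (hM : ∀ c ∈ Icc a b,
      ∫⁻ x, ‖gibbsField U c x‖ₑ ^ p ∂gibbsMeasure U c ≤ ENNReal.ofReal M ^ p) :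
    wasserstein p (gibbsMeasure U a) (gibbsMeasure U b) ≤
      ENNReal.ofReal M * ENNReal.ofReal (b - a) := by
  have hp0 : 0 < p := by linarith
  have hb : 0 < b := ha.trans_le hab
  set ν : Measure ℝ := volume.restrict (Ioo 0 1) with hν
  have hνp : IsProbabilityMeasure ν := ⟨by simp [hν]⟩
  have hQa := hU.aemeasurable_gibbsQuantile ha
  have hQb := hU.aemeasurable_gibbsQuantile hb
  have hQ := hQa.prodMk hQb
  have hmem : ν.map (fun u => (gibbsQuantile U a u, gibbsQuantile U b u)) ∈
      couplings (gibbsMeasure U a) (gibbsMeasure U b) := by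
    refine ⟨Measure.isProbabilityMeasure_map hQ, ?_, ?_⟩
    · rw [Measure.fst, AEMeasurable.map_map_of_aemeasurable measurable_fst.aemeasurable hQ]
      exact hU.map_gibbsQuantile ha
    · rw [Measure.snd, AEMeasurable.map_map_of_aemeasurable measurable_snd.aemeasurable hQ]
      exact hU.map_gibbsQuantile hb
  have hprod : AEMeasurable (Function.uncurry fun u c : ℝ =>
      ‖gibbsField U c (gibbsQuantile U c u)‖ₑ ^ p) (ν.prod (volume.restrict (Ioc a b))) := by
    rw [hν, Measure.prod_restrict]
    have h := hU.continuousOn_gibbsField_gibbsQuantile.mono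
      (prod_mono_right (s := Ioo (0 : ℝ) 1) fun c (hc : c ∈ Ioc a b) => ha.trans hc.1)
    exact (h.aemeasurable (measurableSet_Ioo.prod measurableSet_Ioc)).enorm.pow_const p
  have hcost : ∫⁻ z, edist z.1 z.2 ^ p
      ∂ν.map (fun u => (gibbsQuantile U a u, gibbsQuantile U b u)) ≤
      (ENNReal.ofReal M * ENNReal.ofReal (b - a)) ^ p := by
    rw [lintegral_map' (by fun_prop) hQ]
    calc ∫⁻ u, edist (gibbsQuantile U a u) (gibbsQuantile U b u) ^ p ∂ν
        ≤ ∫⁻ u, ENNReal.ofReal (b - a) ^ (p - 1) *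
            (∫⁻ c in Ioc a b, ‖gibbsField U c (gibbsQuantile U c u)‖ₑ ^ p) ∂ν :=
          setLIntegral_mono' measurableSet_Ioo fun u hu =>
            hU.edist_gibbsQuantile_rpow_le hp ha hab hu
      _ = ENNReal.ofReal (b - a) ^ (p - 1) *
            ∫⁻ c in Ioc a b, ∫⁻ u, ‖gibbsField U c (gibbsQuantile U c u)‖ₑ ^ p ∂ν := by
          rw [lintegral_const_mul' _ _
            (ENNReal.rpow_ne_top_of_nonneg (by linarith) ENNReal.ofReal_ne_top),
            lintegral_lintegral_swap hprod]
      _ ≤ ENNReal.ofReal (b - a) ^ (p - 1) * ∫⁻ c in Ioc a b, ENNReal.ofReal M ^ p := by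
          refine mul_le_mul_right (setLIntegral_mono' measurableSet_Ioc fun c hc => ?_) _
          have hc0 : 0 < c := ha.trans hc.1
          have hmeas := (hU.continuous_gibbsField hc0).measurable
          refine le_trans (le_of_eq ?_) (hM c ⟨hc.1.le, hc.2⟩)
          rw [← hU.map_gibbsQuantile hc0,
            lintegral_map' (by fun_prop) (hU.aemeasurable_gibbsQuantile hc0)]
      _ = (ENNReal.ofReal M * ENNReal.ofReal (b - a)) ^ p := by
          rw [lintegral_const, Measure.restrict_apply_univ, Real.volume_Ioc,
            ENNReal.mul_rpow_of_nonneg _ _ hp0.le]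
          have : ENNReal.ofReal (b - a) ^ p =
              ENNReal.ofReal (b - a) ^ (p - 1) * ENNReal.ofReal (b - a) := by
            conv_rhs => rw [← ENNReal.rpow_one (ENNReal.ofReal (b - a)), ← ENNReal.rpow_mul,
              one_mul, ← ENNReal.rpow_add_of_nonneg _ _ (by linarith) zero_le_one,
              sub_add_cancel]
          rw [this]
          ring
  refine (wasserstein_le_of_mem_couplings hp hmem).trans ?_
  calc _ ≤ ((ENNReal.ofReal M * ENNReal.ofReal (b - a)) ^ p) ^ (1 / p) := by gcongr
    _ = _ := by rw [← ENNReal.rpow_mul, mul_one_div_cancel hp0.ne', ENNReal.rpow_one]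

/-- Clamping `c` at `a > 0` makes the integrand jointly measurable on the whole plane; the clamp is
inactive at `c = β t` when `a = β 0`. -/
theorem measurable_lintegral_gibbsField {p a : ℝ} (ha : 0 < a) :
    Measurable fun c => ∫⁻ x, ‖gibbsField U (max c a) x‖ₑ ^ p ∂gibbsMeasure U (max c a) := by
  have hpos : ∀ c, 0 < max c a := fun c => lt_max_of_lt_right ha
  have hfield : Continuous fun z : ℝ × ℝ => gibbsField U (max z.1 a) z.2 :=
    continuous_iff_continuousAt.2 fun z => (hU.continuousAt_gibbsField (hpos z.1) z.2).comp_of_eq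
      (f := fun z : ℝ × ℝ => (max z.1 a, z.2)) (by fun_prop) rfl
  have hdens : Continuous fun z : ℝ × ℝ => gibbsDensity U (max z.1 a) z.2 :=
    continuous_iff_continuousAt.2 fun z => (hU.continuousAt_gibbsDensity (hpos z.1) z.2).comp_of_eq
      (f := fun z : ℝ × ℝ => (max z.1 a, z.2)) (by fun_prop) rfl
  have h : ∀ c, ∫⁻ x, ‖gibbsField U (max c a) x‖ₑ ^ p ∂gibbsMeasure U (max c a) =
      ∫⁻ x, ENNReal.ofReal (gibbsDensity U (max c a) x) * ‖gibbsField U (max c a) x‖ₑ ^ p := by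
    intro c
    have hmeas := (hU.continuous_gibbsField (hpos c)).measurable
    rw [gibbsMeasure, lintegral_withDensity_eq_lintegral_mul _
      (hU.continuous_gibbsDensity _).measurable.ennreal_ofReal (by fun_prop)]
    rfl
  simp_rw [h]
  exact Measurable.lintegral_prod_right' (hdens.measurable.ennreal_ofReal.mul
    (hfield.measurable.enorm.pow_const p))

end IsConfining

/-! ### Application to the cooling schedule. -/

theorem isConfining_of_tail {U : ℝ → ℝ} (hcont : Continuous U) (h0 : ∀ x, 0 ≤ U x)
    (htail : ∃ α > 0, ∃ R > 0, ∀ x : ℝ, R < |x| → α * |x| ^ 2 ≤ U x) : IsConfining U := by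
  obtain ⟨α, hα, R, hR, h⟩ := htail
  refine ⟨hcont, h0, α, hα, α * R ^ 2, fun x => ?_⟩
  rcases lt_or_ge R |x| with hx | hx
  · have := h x hx
    rw [sq_abs] at this
    have : 0 ≤ α * R ^ 2 := by positivity
    linarith
  · have h1 : x ^ 2 ≤ R ^ 2 := by rw [← sq_abs x]; gcongr
    nlinarith [h0 x]

theorem velocity_eq (U β : ℝ → ℝ) (T t : ℝ) :
    velocity U β T t = derivWithin β (Icc 0 T) t • gibbsField U (β t) := by
  ext x
  simp only [velocity, gibbsField, gibbsFlux, gibbsCurve, Pi.smul_apply, smul_eq_mul]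
  ring

end GibbsCurve

open GibbsCurve in
theorem mainTheorem6
    (U : ℝ → ℝ)
    -- `U` is `C¹`, its minimum is `0`, and the set of minimizers is compact
    (hU : ContDiff ℝ 1 U)
    (hmin : IsLeast (range U) 0)
    (hcompact : IsCompact {x | U x = 0})
    -- quadratic tail
    (htail : ∃ α > 0, ∃ R > 0, ∀ x : ℝ, R < |x| → α * |x| ^ 2 ≤ U x)
    -- smooth non-decreasing cooling schedule `β : [0, T] → [1, ∞)`
    (T : ℝ) (hT : 0 < T)
    (β : ℝ → ℝ)
    (hβ : ContDiffOn ℝ ∞ β (Icc 0 T))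
    (hβ_mono : MonotoneOn β (Icc 0 T))
    (hβ_one : ∀ t ∈ Icc 0 T, 1 ≤ β t)
    -- gradient condition at the lowest inverse temperature `β 0`
    (hgrad : ∃ R : ℝ, ∃ α > 0, ∀ x : ℝ, R < |x| →
      α * |x| ≤ x * (β 0 * deriv U x - deriv U x / U x))
    (p : ℝ) (hp : 1 ≤ p) :
    -- `U` is `μ_t`-integrable and `v_t ∈ L^p(μ_t)` for every `t`
    (∀ t ∈ Icc 0 T, Integrable U (GibbsCurve.gibbsCurve U β t) ∧
      MemLp (GibbsCurve.velocity U β T t) (ENNReal.ofReal p) (GibbsCurve.gibbsCurve U β t)) ∧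
    -- `t ↦ ‖v_t‖_{L^p(μ_t)}` is in `L¹([0, T])`
    IntegrableOn (fun t => (eLpNorm (GibbsCurve.velocity U β T t) (ENNReal.ofReal p)
      (GibbsCurve.gibbsCurve U β t)).toReal) (Icc 0 T) ∧
    -- the Gibbs curve is absolutely continuous in `𝒫_p(ℝ)`
    GibbsCurve.IsAbsolutelyContinuousCurve p 0 T (GibbsCurve.gibbsCurve U β) := by
  have hconf := isConfining_of_tail hU.continuous (fun x => hmin.2 ⟨x, rfl⟩) htail
  have hp0 : 0 < p := by linarith
  have h0T : (0 : ℝ) ∈ Icc 0 T := ⟨le_rfl, hT.le⟩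
  have hTT : T ∈ Icc 0 T := ⟨hT.le, le_rfl⟩
  have hβ0 : 0 < β 0 := one_pos.trans_le (hβ_one 0 h0T)
  have hβpos : ∀ t ∈ Icc 0 T, 0 < β t := fun t ht => one_pos.trans_le (hβ_one t ht)
  have hβmem : ∀ t ∈ Icc 0 T, β t ∈ Icc (β 0) (β T) := fun t ht =>
    ⟨hβ_mono h0T ht ht.1, hβ_mono ht hTT ht.2⟩
  obtain ⟨C, hC, hfield⟩ := hconf.exists_abs_gibbsField_le (b := β T)
    (hU.differentiable one_ne_zero) hβ0 hgrad
  obtain ⟨M, hM0, hM⟩ := hconf.exists_lintegral_le (b := β T) hp hβ0 hC.le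
  have hMf : ∀ c ∈ Icc (β 0) (β T),
      ∫⁻ x, ‖gibbsField U c x‖ₑ ^ p ∂gibbsMeasure U c ≤ ENNReal.ofReal M ^ p := fun c hc =>
    hM c hc _ (hfield c hc)
  have hp1 : ENNReal.ofReal p ≠ 0 := (ENNReal.ofReal_pos.2 hp0).ne'
  have hnorm : ∀ t, eLpNorm (velocity U β T t) (ENNReal.ofReal p) (gibbsCurve U β t) =
      ‖derivWithin β (Icc 0 T) t‖ₑ *
        (∫⁻ x, ‖gibbsField U (β t) x‖ₑ ^ p ∂gibbsMeasure U (β t)) ^ (1 / p) := by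
    intro t
    rw [velocity_eq, eLpNorm_const_smul,
      eLpNorm_eq_lintegral_rpow_enorm_toReal hp1 ENNReal.ofReal_ne_top,
      ENNReal.toReal_ofReal hp0.le, gibbsCurve]
  have hnorm_le : ∀ t ∈ Icc 0 T,
      eLpNorm (velocity U β T t) (ENNReal.ofReal p) (gibbsCurve U β t) ≤
        ‖derivWithin β (Icc 0 T) t‖ₑ * ENNReal.ofReal M := fun t ht => by
    rw [hnorm]
    gcongr
    calc _ ≤ (ENNReal.ofReal M ^ p) ^ (1 / p) := by gcongr; exact hMf _ (hβmem t ht)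
      _ = _ := by rw [← ENNReal.rpow_mul, mul_one_div_cancel hp0.ne', ENNReal.rpow_one]
  have hder : ContinuousOn (derivWithin β (Icc 0 T)) (Icc 0 T) :=
    hβ.continuousOn_derivWithin (uniqueDiffOn_Icc hT) (by simp)
  refine ⟨fun t ht => ⟨hconf.integrable_potential (hβpos t ht), ?_, ?_⟩, ?_, ?_⟩
  · rw [velocity_eq]
    exact ((hconf.continuous_gibbsField (hβpos t ht)).const_smul _).aestronglyMeasurable
  · exact (hnorm_le t ht).trans_lt (ENNReal.mul_lt_top enorm_lt_top ENNReal.ofReal_lt_top)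
  · obtain ⟨K, hK⟩ := isCompact_Icc.exists_bound_of_continuousOn hder
    have hmeas : AEMeasurable (fun t => eLpNorm (velocity U β T t) (ENNReal.ofReal p)
        (gibbsCurve U β t)) (volume.restrict (Icc 0 T)) := by
      have h1 := (hconf.measurable_lintegral_gibbsField (p := p) hβ0).comp_aemeasurable
        (hβ.continuousOn.aemeasurable (μ := volume) measurableSet_Icc)
      refine ((hder.aemeasurable measurableSet_Icc).enorm.mul (h1.pow_const (1 / p))).congr ?_
      filter_upwards [ae_restrict_mem measurableSet_Icc] with t ht
      rw [hnorm]
      simp only [Pi.mul_apply, Function.comp_apply, max_eq_left (hβmem t ht).1]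
    refine Integrable.mono' (g := fun _ => K * M) (integrable_const _)
      hmeas.ennreal_toReal.aestronglyMeasurable ?_
    filter_upwards [ae_restrict_mem measurableSet_Icc] with t ht
    rw [Real.norm_of_nonneg ENNReal.toReal_nonneg]
    have h1 := ENNReal.toReal_mono (ENNReal.mul_ne_top enorm_ne_top ENNReal.ofReal_ne_top)
      (hnorm_le t ht)
    rw [ENNReal.toReal_mul, toReal_enorm, ENNReal.toReal_ofReal hM0] at h1
    exact h1.trans (mul_le_mul_of_nonneg_right (hK t ht) hM0)
  -- Composing the Lipschitz bound in inverse temperature with the Lipschitz schedule gives the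
  -- constant `M * L`.
  · obtain ⟨L, hL⟩ := hβ.exists_lipschitzOnWith (by simp) (convex_Icc 0 T) isCompact_Icc
    have key : ∀ s ∈ Icc 0 T, ∀ t ∈ Icc 0 T, s ≤ t →
        wasserstein p (gibbsCurve U β s) (gibbsCurve U β t) ≤
          ENNReal.ofReal (M * L * |s - t|) := by
      intro s hs t ht hst
      refine (hconf.wasserstein_gibbsMeasure_le hp (hβpos s hs) (hβ_mono hs ht hst) fun c hc =>
        hMf c ⟨(hβmem s hs).1.trans hc.1, hc.2.trans (hβmem t ht).2⟩).trans ?_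
      rw [← ENNReal.ofReal_mul hM0, mul_assoc]
      refine ENNReal.ofReal_le_ofReal (mul_le_mul_of_nonneg_left ?_ hM0)
      have h1 := hL.dist_le_mul s hs t ht
      rw [Real.dist_eq, Real.dist_eq, abs_sub_comm] at h1
      exact (le_abs_self _).trans h1
    refine isAbsolutelyContinuousCurve_of_lipschitz hp hT.le (L := M * L)
      (fun t ht => hconf.hasFiniteMoment_gibbsMeasure hp (hβpos t ht)) fun s hs t ht => ?_
    rcases le_total s t with hst | hst
    · exact key s hs t ht hst
    · rw [wasserstein_comm, abs_sub_comm]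
      exact key t ht s hs hst
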